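/- Let $M$ be a closed (compact, without boundary) smooth manifold and let $g$ be a smooth Riemannian metric on $M$. Let $\mathcal M(TM)$ be the set of Borel probability measures $\mu$ on $TM$ with $\int_{TM}\|v\|_x\,d\mu<\infty$ that are closed, i.e. $\int_{TM} df_x(v)\,d\mu=0$ for every $f\in C^1(M)$. The rotation vector $\rho(\mu)\in H_1(M;\mathbb R)$ of such a measure is defined by $\langle[\omega],\rho(\mu)\rangle=\int_{TM}\omega_x(v)\,d\mu(x,v)$ for every closed $1$-form $\omega$ on $M$. With $L_g(x,v)=\tfrac12 g_x(v,v)$, Mather's $\beta$-function is $$\beta_g\colon H_1(M;\mathbb R)\to\mathbb R,\qquad \beta_g(h)=\min_{\mu\in\mathcal M(TM),\ \rho(\mu)=h}\ \int_{TM}L_g\,d\mu .$$ The Mather measures of rotation vector $h$ are the measures realizing this minimum, and the projected Mather set $\mathcal M_g^h\subseteq M$ is the image under $TM\to M$ of the union of the supports of these measures. Put $$\mathcal H_{g}=\{h\in H_1(M;\mathbb R)\setminus\{0\}:\ \mathcal M_{g}^h=M\}.$$ Let $g_1$ and $g_2$ be two conformally equivalent smooth Riemannian metrics on $M$, i.e.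 $g_2=\varphi\, g_1$ for some positive function $\varphi\in C^\infty(M)$, let $m=\max_M\varphi$, and assume that $\mathcal H_{g_1}\neq\emptyset$. Then $$\beta_{g_2}(h)=m\,\beta_{g_1}(h)\ \text{ for some } h\in\mathcal H_{g_1}\quad\Longleftrightarrow\quad g_2=m\,g_1 .$$ -/

import Mathlib

open scoped Manifold ContDiff

universe u

noncomputable section

namespace MatherTheory

section Homology

open CategoryTheory CategoryTheory.Limits AlgebraicTopology

variable (M : Type u) [TopologicalSpace M]

/-- The coefficient module `ℝ`, lifted to the universe of the space. -/
abbrev coeff : ModuleCat.{u} ℝ := ModuleCat.of ℝ (ULift.{u} ℝ)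

/-- The singular chain complex of `M` with real coefficients. -/
abbrev singularComplex : ChainComplex (ModuleCat.{u} ℝ) ℕ :=
  ((singularChainComplexFunctor (ModuleCat.{u} ℝ)).obj coeff.{u}).obj (TopCat.of M)

/-- The first real homology group `H₁(M; ℝ)` (singular homology). -/
abbrev H1 : ModuleCat.{u} ℝ :=
  (singularComplex M).homology 1

variable {M}

/-- The singular chain `1 · σ` of a singular `1`-simplex `σ`. -/
def simplexChain (σ : C(stdSimplex ℝ (Fin 2), M)) : (singularComplex M).X 1 :=
  (SSet.ιChainComplex (R := coeff.{u}) (TopCat.toSSet.obj (TopCat.of M))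
    ((TopCat.toSSetObjEquiv (TopCat.of M) (.op (SimplexCategory.mk 1))).symm σ)).hom (ULift.up 1)

/-- A curve `γ`, restricted to `[0, 1]`, as a singular `1`-simplex: the point of the standard
simplex with barycentric coordinates `(1 - t, t)` is sent to `γ t`. -/
def curveSimplex (γ : ℝ → M) (hγ : Continuous γ) : C(stdSimplex ℝ (Fin 2), M) where
  toFun s := γ (s.1 1)
  continuous_toFun := hγ.comp ((continuous_apply 1).comp continuous_subtype_val)

end Homology

section Manifold

open MeasureTheory

variable {n : ℕ} {M : Type u} [TopologicalSpace M] [ChartedSpace (EuclideanSpace ℝ (Fin n)) M]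
  [IsManifold (𝓡 n) ∞ M]

/-- The tangent bundle carries its Borel σ-algebra. -/
instance : MeasurableSpace (TangentBundle (𝓡 n) M) := borel _

instance : BorelSpace (TangentBundle (𝓡 n) M) := ⟨rfl⟩

variable (n M) in
/-- A smooth Riemannian metric on `M`. -/
abbrev Metric := Bundle.ContMDiffRiemannianMetric (𝓡 n) ∞ (EuclideanSpace ℝ (Fin n))
  (fun x : M ↦ TangentSpace (𝓡 n) x)

variable (n M) in
/-- Smooth differential `1`-forms on `M`: smooth sections of the cotangent bundle. -/
structure OneForm where
  toFun (x : M) : TangentSpace (𝓡 n) x →L[ℝ] ℝ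
  contMDiff : ContMDiff (𝓡 n) ((𝓡 n).prod 𝓘(ℝ, EuclideanSpace ℝ (Fin n) →L[ℝ] ℝ)) ∞
    (fun x ↦ Bundle.TotalSpace.mk' (EuclideanSpace ℝ (Fin n) →L[ℝ] ℝ)
      (E := fun x : M ↦ TangentSpace (𝓡 n) x →L[ℝ] ℝ) x (toFun x))

/-- The integral of a `1`-form along a curve parametrized by `[0, 1]`. -/
def OneForm.curveIntegral (α : OneForm n M) (γ : ℝ → M) : ℝ :=
  ∫ t in (0 : ℝ)..1, α.toFun (γ t) (mfderiv 𝓘(ℝ, ℝ) (𝓡 n) γ t (1 : ℝ))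

/-- `α` is a closed `1`-form whose de Rham class is the element `φ` of
`H¹(M; ℝ) = Hom(H₁(M; ℝ), ℝ)`: integration of `α` over smooth curves is the restriction to smooth
`1`-simplices of a real singular cochain `c` which represents `φ`, that is, `c z = φ [z]` for
every singular `1`-cycle `z`. In particular the integral of `α` over every smooth cycle `z` is
`φ [z]`, which forces `α` to be closed and determines `φ`. -/
def OneForm.HasClass (α : OneForm n M) (φ : H1 M →ₗ[ℝ] ℝ) : Prop :=
  ∃ c : (singularComplex M).X 1 →ₗ[ℝ] ℝ,
    (∀ z : (singularComplex M).cycles 1,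
      c (((singularComplex M).iCycles 1).hom z) = φ (((singularComplex M).homologyπ 1).hom z)) ∧
    ∀ (γ : ℝ → M) (hγ : ContMDiff 𝓘(ℝ, ℝ) (𝓡 n) ∞ γ),
      c (simplexChain (curveSimplex γ hγ.continuous)) = α.curveIntegral γ

/-- The Lagrangian `L_g (x, v) = ½ ‖v‖ₓ²` of the geodesic flow. -/
def lagrangian (g : Metric n M) (p : TangentBundle (𝓡 n) M) : ℝ :=
  1 / 2 * g.inner p.1 p.2 p.2

/-- The set `𝓜(TM)`: Borel probability measures on `TM` with finite first moment that are closed,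
i.e. `∫ df_x(v) dμ = 0` for every `C¹` function `f`. -/
structure IsClosedMeasure (g : Metric n M) (μ : Measure (TangentBundle (𝓡 n) M)) : Prop where
  isProbabilityMeasure : IsProbabilityMeasure μ
  integrable_norm : Integrable (fun p ↦ √(g.inner p.1 p.2 p.2)) μ
  closed (f : M → ℝ) (hf : ContMDiff (𝓡 n) 𝓘(ℝ, ℝ) 1 f) :
    ∫ p, (show ℝ from mfderiv (𝓡 n) 𝓘(ℝ, ℝ) f p.1 p.2) ∂μ = 0

/-- `h ∈ H₁(M; ℝ)` is the rotation vector `ρ(μ)` of `μ`: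
`∫ α_x(v) dμ(x, v) = ⟨[α], h⟩` for every closed `1`-form `α`. -/
def HasRotationVector (μ : Measure (TangentBundle (𝓡 n) M)) (h : H1 M) : Prop :=
  ∀ (α : OneForm n M) (φ : H1 M →ₗ[ℝ] ℝ), α.HasClass φ → ∫ p, α.toFun p.1 p.2 ∂μ = φ h

/-- Mather's `β`-function: the minimal action of the measures in `𝓜(TM)` with rotation
vector `h`. Measures of infinite action are discarded. -/
def beta (g : Metric n M) (h : H1 M) : ℝ :=
  sInf {a : ℝ | ∃ μ : Measure (TangentBundle (𝓡 n) M), IsClosedMeasure g μ ∧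
    HasRotationVector μ h ∧ Integrable (lagrangian g) μ ∧ ∫ p, lagrangian g p ∂μ = a}

/-- `μ` is a Mather measure of rotation vector `h`: it realizes the minimum in `β_g(h)`. -/
structure IsMatherMeasure (g : Metric n M) (h : H1 M)
    (μ : Measure (TangentBundle (𝓡 n) M)) : Prop where
  isClosedMeasure : IsClosedMeasure g μ
  hasRotationVector : HasRotationVector μ h
  integrable_lagrangian : Integrable (lagrangian g) μ
  integral_lagrangian : ∫ p, lagrangian g p ∂μ = beta g h

/-- The Mather set of homology class `h`: the union of the supports of the Mather measures. -/
def matherSet (g : Metric n M) (h : H1 M) : Set (TangentBundle (𝓡 n) M) :=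
  ⋃ μ ∈ {μ | IsMatherMeasure g h μ}, μ.support

/-- The projected Mather set of homology class `h`. -/
def projectedMatherSet (g : Metric n M) (h : H1 M) : Set M :=
  (fun p : TangentBundle (𝓡 n) M ↦ p.1) '' matherSet g h

/-- The set `𝓗_g` of nonzero classes whose projected Mather set is all of `M`. -/
def fullClasses (g : Metric n M) : Set (H1 M) :=
  {h | h ≠ 0 ∧ projectedMatherSet g h = Set.univ}

end Manifold

end MatherTheory

end

/-! If `g₂ = m g₁`, all actions scale by `m`. Conversely, let `μ` be a Mather measure of `g₁` of
class `h`. Then `β_{g₂}(h) ≤ ∫ φ L_{g₁} dμ ≤ m ∫ L_{g₁} dμ = m β_{g₁}(h)`, and the assumed equality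
forces `(m - φ) L_{g₁} = 0` `μ`-almost everywhere (`IsMatherMeasure.ae_conformal_eq`), hence by
continuity on the support of `μ`. There `L_{g₁}` is a positive constant, so `φ = m` on the projected
Mather set, which is `M`.

Constancy of the speed (`IsMatherMeasure.exists_speed_eq`): rescaling all velocities to the mean
speed `c`, with a compensating density, keeps the measure closed and of class `h` and gives it
action `c²/2`. Minimality then makes the variance of the speed vanish.

Positivity of `c` for `h ≠ 0` is where topology enters: some closed `1`-form must pair nontrivially
with `h`. This is the surjectivity half of de Rham's theorem in degree one
(`exists_oneForm_hasClass`), proved by correcting a singular cocycle by a coboundary until its local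
primitives are smooth. -/

noncomputable section

namespace MatherTheory

/-! ### Singular chains, and cocycles representing a functional on `H₁`. -/

section Homology

open CategoryTheory CategoryTheory.Limits AlgebraicTopology Simplicial

variable {M : Type u} [TopologicalSpace M]

/-- The singular chain `1 · σ` of a singular simplex `σ` of any dimension. -/
def singleChain {k : ℕ} (σ : C(stdSimplex ℝ (Fin (k + 1)), M)) : (singularComplex M).X k :=
  (SSet.ιChainComplex (R := coeff.{u}) (TopCat.toSSet.obj (TopCat.of M))
    ((TopCat.toSSetObjEquiv (TopCat.of M) (.op (SimplexCategory.mk k))).symm σ)).hom (ULift.up 1)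

theorem d_singleChain {k : ℕ} (σ : C(stdSimplex ℝ (Fin (k + 2)), M)) :
    ((singularComplex M).d (k + 1) k).hom (singleChain σ) =
      ∑ i : Fin (k + 2), (-1 : ℤ) ^ (i : ℕ) •
        singleChain (σ.comp ⟨stdSimplex.map i.succAbove, by continuity⟩) := by
  have h := SSet.ιChainComplex_d (C := ModuleCat.{u} ℝ) (TopCat.toSSet.obj (TopCat.of M)) coeff.{u}
    ((TopCat.toSSetObjEquiv (TopCat.of M) (.op (SimplexCategory.mk (k + 1)))).symm σ)
  have h2 := congrArg (fun f => f.hom (ULift.up (1 : ℝ))) h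
  refine h2.trans ?_
  simp
  rfl

/-- The linear functional on singular chains with prescribed values on the simplices. -/
theorem exists_linearMap_singleChain {k : ℕ} (F : C(stdSimplex ℝ (Fin (k + 1)), M) → ℝ) :
    ∃ l : (singularComplex M).X k →ₗ[ℝ] ℝ, ∀ σ, l (singleChain σ) = F σ := by
  let f : (singularComplex M).X k ⟶ coeff.{u} :=
    Sigma.desc (f := fun (_ : (TopCat.toSSet.obj (TopCat.of M)) _⦋k⦌) => coeff.{u}) fun x =>
      F (TopCat.toSSetObjEquiv (TopCat.of M) (.op (SimplexCategory.mk k)) x) • 𝟙 coeff.{u}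
  refine ⟨ULift.moduleEquiv.toLinearMap ∘ₗ f.hom, fun σ => ?_⟩
  have h : SSet.ιChainComplex (R := coeff.{u}) (TopCat.toSSet.obj (TopCat.of M))
    ((TopCat.toSSetObjEquiv (TopCat.of M) (.op (SimplexCategory.mk k))).symm σ) ≫ f =
      F σ • 𝟙 coeff.{u} := by
    refine (Sigma.ι_desc _ _).trans ?_
    simp
  have h2 := congrArg (fun f => ULift.down (f.hom (ULift.up (1 : ℝ)))) h
  refine Eq.trans ?_ (h2.trans ?_)
  · rfl
  · simp

/-- Over a field the cycles are a direct summand: `φ ∘ π` extends from cycles to chains along a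
linear retraction `r`, and it kills boundaries because their homology class is zero. -/
theorem exists_cocycle (φ : H1 M →ₗ[ℝ] ℝ) : ∃ c : (singularComplex M).X 1 →ₗ[ℝ] ℝ,
    (∀ z : (singularComplex M).cycles 1,
      c (((singularComplex M).iCycles 1).hom z) = φ (((singularComplex M).homologyπ 1).hom z)) ∧
    ∀ b : (singularComplex M).X 2, c (((singularComplex M).d 2 1).hom b) = 0 := by
  have hinj : Function.Injective ((singularComplex M).iCycles 1).hom :=
    (ModuleCat.mono_iff_injective _).1 inferInstance
  obtain ⟨r, hr⟩ := ((singularComplex M).iCycles 1).hom.exists_leftInverse_of_injective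
    (LinearMap.ker_eq_bot.2 hinj)
  have hr' (z) : r (((singularComplex M).iCycles 1).hom z) = z := LinearMap.congr_fun hr z
  refine ⟨φ ∘ₗ ((singularComplex M).homologyπ 1).hom ∘ₗ r, fun z => ?_, fun b => ?_⟩
  · simp [hr']
  · have h1 : (singularComplex M).d 2 1 = (singularComplex M).toCycles 2 1 ≫
      (singularComplex M).iCycles 1 := by simp
    have h2 : (singularComplex M).toCycles 2 1 ≫ (singularComplex M).homologyπ 1 = 0 := by simp
    have h3 := congrArg (fun f => f.hom b) h2
    rw [h1]
    simp only [ModuleCat.hom_comp, LinearMap.comp_apply, hr']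
    simp only [ModuleCat.hom_comp, LinearMap.comp_apply] at h3
    rw [h3]
    simp

end Homology
-- Cocycles evaluated on curves, and their primitives on contractible sets.
section Curves

open Set Topology CategoryTheory

variable {M : Type u} [TopologicalSpace M]

/-- A singular `1`-cochain is a cocycle if it vanishes on boundaries. -/
def IsCocycle (c : (singularComplex M).X 1 →ₗ[ℝ] ℝ) : Prop :=
  ∀ b : (singularComplex M).X 2, c (((singularComplex M).d 2 1).hom b) = 0

open Classical in
/-- The value of a singular cochain on the restriction of a curve to `[0, 1]`. -/
def curveVal (c : (singularComplex M).X 1 →ₗ[ℝ] ℝ) (γ : ℝ → M) : ℝ :=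
  -- Continuity is tested on `[0, 1]` only, so the values of `γ` elsewhere are irrelevant; other
  -- curves get the default value `0`.
  if h : Continuous fun s : stdSimplex ℝ (Fin 2) ↦ γ (s.1 1) then c (singleChain ⟨_, h⟩) else 0

theorem curveVal_of_continuous (c : (singularComplex M).X 1 →ₗ[ℝ] ℝ) {γ : ℝ → M}
    (h : Continuous fun s : stdSimplex ℝ (Fin 2) ↦ γ (s.1 1)) :
    curveVal c γ = c (singleChain ⟨_, h⟩) := dif_pos h

theorem curveVal_eq_simplexChain (c : (singularComplex M).X 1 →ₗ[ℝ] ℝ) {γ : ℝ → M}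
    (h : Continuous γ) : curveVal c γ = c (simplexChain (curveSimplex γ h)) :=
  curveVal_of_continuous c (curveSimplex γ h).continuous

theorem stdSimplex_mem_Icc (s : stdSimplex ℝ (Fin 2)) : s.1 1 ∈ Icc (0 : ℝ) 1 := by
  have h := s.2.2
  rw [Fin.sum_univ_two] at h
  exact ⟨s.2.1 1, by linarith [s.2.1 0]⟩

theorem curveVal_congr (c : (singularComplex M).X 1 →ₗ[ℝ] ℝ) {γ γ' : ℝ → M}
    (h : EqOn γ γ' (Icc 0 1)) : curveVal c γ = curveVal c γ' := by
  have h1 : (fun s : stdSimplex ℝ (Fin 2) ↦ γ (s.1 1)) = fun s ↦ γ' (s.1 1) :=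
    funext fun s ↦ h (stdSimplex_mem_Icc s)
  by_cases h2 : Continuous fun s : stdSimplex ℝ (Fin 2) ↦ γ (s.1 1)
  · have h3 : Continuous fun s : stdSimplex ℝ (Fin 2) ↦ γ' (s.1 1) := h1 ▸ h2
    rw [curveVal_of_continuous c h2, curveVal_of_continuous c h3]
    congr 3
  · have h3 : ¬ Continuous fun s : stdSimplex ℝ (Fin 2) ↦ γ' (s.1 1) := h1 ▸ h2
    rw [curveVal, curveVal, dif_neg h2, dif_neg h3]

theorem continuous_simplex_curve {γ : ℝ → M} (h : ContinuousOn γ (Icc 0 1)) :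
    Continuous fun s : stdSimplex ℝ (Fin 2) ↦ γ (s.1 1) :=
  h.comp_continuous ((continuous_apply 1).comp continuous_subtype_val) stdSimplex_mem_Icc

/-- The cocycle condition on the affine singular `2`-simplex with vertices `p, q, r`, composed with
`K`. -/
theorem curveVal_triangle {c : (singularComplex M).X 1 →ₗ[ℝ] ℝ} (hc : IsCocycle c)
    {K : ℝ × ℝ → M} (hK : Continuous K) (p q r : ℝ × ℝ) :
    curveVal c (fun t ↦ K ((1 - t) • p + t • q)) + curveVal c (fun t ↦ K ((1 - t) • q + t • r)) =
      curveVal c (fun t ↦ K ((1 - t) • p + t • r)) := by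
  let T : C(stdSimplex ℝ (Fin 3), M) :=
    ⟨fun s ↦ K (s.1 0 • p + s.1 1 • q + s.1 2 • r), by
      have h (i : Fin 3) : Continuous fun s : stdSimplex ℝ (Fin 3) ↦ s.1 i :=
        (continuous_apply i).comp continuous_subtype_val
      exact hK.comp ((((h 0).smul continuous_const).add ((h 1).smul continuous_const)).add
        ((h 2).smul continuous_const))⟩
  have hcont (a b : ℝ × ℝ) : Continuous fun s : stdSimplex ℝ (Fin 2) ↦
      K ((1 - s.1 1) • a + s.1 1 • b) :=
    continuous_simplex_curve (γ := fun t ↦ K ((1 - t) • a + t • b))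
      (Continuous.continuousOn (by fun_prop))
  have hs (s : stdSimplex ℝ (Fin 2)) : s.1 0 = 1 - s.1 1 := by
    have h := s.2.2
    rw [Fin.sum_univ_two] at h
    linarith
  have e2 : Fin.succAbove (2 : Fin 3) (1 : Fin 2) = 1 := rfl
  have key := hc (singleChain T)
  rw [d_singleChain, map_sum, Fin.sum_univ_three] at key
  have h0 : T.comp ⟨stdSimplex.map (Fin.succAbove 0), by continuity⟩ = ⟨_, hcont q r⟩ := by
    ext s
    simp [T, stdSimplex.map, FunOnFinite.linearMap_apply_apply, Finset.sum_filter,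
      Fin.sum_univ_two, ← hs]
    rfl
  have h1 : T.comp ⟨stdSimplex.map (Fin.succAbove 1), by continuity⟩ = ⟨_, hcont p r⟩ := by
    ext s
    simp [T, stdSimplex.map, FunOnFinite.linearMap_apply_apply, Finset.sum_filter,
      Fin.sum_univ_two, ← hs]
    rfl
  have h2 : T.comp ⟨stdSimplex.map (Fin.succAbove 2), by continuity⟩ = ⟨_, hcont p q⟩ := by
    ext s
    simp [T, stdSimplex.map, FunOnFinite.linearMap_apply_apply, Finset.sum_filter,
      Fin.sum_univ_two, ← hs, e2]
    rfl
  rw [h0, h1, h2] at key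
  rw [curveVal_of_continuous c (hcont p q), curveVal_of_continuous c (hcont q r),
    curveVal_of_continuous c (hcont p r)]
  simp at key
  linarith

theorem curveVal_const {c : (singularComplex M).X 1 →ₗ[ℝ] ℝ} (hc : IsCocycle c) (x : M) :
    curveVal c (fun _ ↦ x) = 0 := by
  have := curveVal_triangle hc (K := fun _ ↦ x) continuous_const 0 0 0
  linarith

/-- The square is cut into two triangles along its diagonal. -/
theorem curveVal_square {c : (singularComplex M).X 1 →ₗ[ℝ] ℝ} (hc : IsCocycle c)
    {K : ℝ × ℝ → M} (hK : Continuous K) :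
    curveVal c (fun u ↦ K (0, u)) + curveVal c (fun t ↦ K (t, 1)) =
      curveVal c (fun t ↦ K (t, 0)) + curveVal c (fun u ↦ K (1, u)) := by
  have h1 := curveVal_triangle hc hK (0, 0) (0, 1) (1, 1)
  have h2 := curveVal_triangle hc hK (0, 0) (1, 0) (1, 1)
  simp at h1 h2
  linarith

theorem curveVal_segments {c : (singularComplex M).X 1 →ₗ[ℝ] ℝ} (hc : IsCocycle c)
    {γ : ℝ → M} (hγ : Continuous γ) (p q r : ℝ) :
    curveVal c (fun t ↦ γ ((1 - t) * p + t * q)) + curveVal c (fun t ↦ γ ((1 - t) * q + t * r)) =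
      curveVal c (fun t ↦ γ ((1 - t) * p + t * r)) := by
  simpa using curveVal_triangle hc (hγ.comp continuous_fst) (p, 0) (q, 0) (r, 0)

/-- On curves in `U`, the cochain `c` is the coboundary of `f`. -/
def HasPrimitiveOn (c : (singularComplex M).X 1 →ₗ[ℝ] ℝ) (f : M → ℝ) (U : Set M) : Prop :=
  ∀ γ : ℝ → M, ContinuousOn γ (Icc 0 1) → MapsTo γ (Icc 0 1) U →
    curveVal c γ = f (γ 1) - f (γ 0)

/-- `H` contracts `U` to the point `p`. -/
structure IsContractionOn (H : ℝ × M → M) (p : M) (U : Set M) : Prop where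
  continuousOn : ContinuousOn H (univ ×ˢ U)
  zero : ∀ y ∈ U, H (0, y) = p
  one : ∀ y ∈ U, H (1, y) = y
  mem : ∀ t, ∀ y ∈ U, H (t, y) ∈ U

/-- Poincaré lemma: apply `curveVal_square` to `(t, u) ↦ H (u, γ t)`. The side `u = 0` is constant,
the side `u = 1` is `γ`, and the other two are the contraction paths of the endpoints. -/
theorem IsContractionOn.hasPrimitiveOn {c : (singularComplex M).X 1 →ₗ[ℝ] ℝ} (hc : IsCocycle c)
    {H : ℝ × M → M} {p : M} {U : Set M} (h : IsContractionOn H p U) :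
    HasPrimitiveOn c (fun y ↦ curveVal c fun t ↦ H (t, y)) U := by
  intro γ hγ hU
  -- Clamping the parameter makes the square map continuous on the whole plane.
  let γ' : ℝ → M := fun t ↦ γ (projIcc (0 : ℝ) 1 zero_le_one t)
  have hγ' : Continuous γ' := hγ.comp_continuous (by fun_prop) fun t ↦ (projIcc _ _ _ t).2
  have hU' (t) : γ' t ∈ U := hU (projIcc _ _ _ t).2
  have heq : EqOn γ' γ (Icc 0 1) := fun t ht ↦ by simp [γ', projIcc_of_mem _ ht]
  have hsq := curveVal_square hc (K := fun z ↦ H (z.2, γ' z.1))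
    (h.continuousOn.comp_continuous (by fun_prop) fun z ↦ ⟨mem_univ _, hU' _⟩)
  simp only [h.zero _ (hU' _), h.one _ (hU' _), curveVal_const hc] at hsq
  rw [curveVal_congr c (fun t ht ↦ heq ht : EqOn (fun t ↦ γ' t) γ (Icc 0 1)),
    heq (left_mem_Icc.2 zero_le_one), heq (right_mem_Icc.2 zero_le_one)] at hsq
  change curveVal c γ = curveVal c (fun t ↦ H (t, γ 1)) - curveVal c (fun t ↦ H (t, γ 0))
  linarith

theorem IsContractionOn.primitive_eq {c : (singularComplex M).X 1 →ₗ[ℝ] ℝ}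
    {H : ℝ × M → M} {p : M} {U V : Set M} (h : IsContractionOn H p U) (hUV : U ⊆ V)
    {f : M → ℝ} (hf : HasPrimitiveOn c f V) {y : M} (hy : y ∈ U) :
    f y = f p + curveVal c fun t ↦ H (t, y) := by
  have := hf (fun t ↦ H (t, y))
    (h.continuousOn.comp (Continuous.continuousOn (by fun_prop)) fun t _ ↦ ⟨mem_univ _, hy⟩)
    (fun t _ ↦ hUV (h.mem t y hy))
  simp only [h.zero y hy, h.one y hy] at this
  linarith

/-- Radial contraction of a ball in a chart; the time is clamped to `[0, 1]` so that the contraction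
stays in the ball for every real time. -/
theorem exists_isContractionOn {E : Type*} [NormedAddCommGroup E] [NormedSpace ℝ E]
    [ChartedSpace E M] (p : M) {N : Set M} (hN : N ∈ 𝓝 p) :
    ∃ (U : Set M) (H : ℝ × M → M), IsOpen U ∧ p ∈ U ∧ U ⊆ N ∧ IsContractionOn H p U := by
  set e := chartAt E p
  have hp : p ∈ e.source := mem_chart_source E p
  have h1 : e.target ∩ e.symm ⁻¹' N ∈ 𝓝 (e p) := by
    refine Filter.inter_mem (e.open_target.mem_nhds (e.map_source hp)) ?_
    apply (e.continuousAt_symm (e.map_source hp)).preimage_mem_nhds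
    rwa [e.left_inv hp]
  obtain ⟨r, hr, hball⟩ := Metric.mem_nhds_iff.1 h1
  have hmem (t : ℝ) {y : E} (hy : y ∈ Metric.ball (e p) r) :
      e p + (projIcc (0 : ℝ) 1 zero_le_one t : ℝ) • (y - e p) ∈ Metric.ball (e p) r := by
    have := (projIcc (0 : ℝ) 1 zero_le_one t).2
    exact (convex_ball (e p) r).add_smul_sub_mem (Metric.mem_ball_self hr) hy this
  refine ⟨e.source ∩ e ⁻¹' Metric.ball (e p) r,
    fun z ↦ e.symm (e p + (projIcc (0 : ℝ) 1 zero_le_one z.1 : ℝ) • (e z.2 - e p)),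
    e.isOpen_inter_preimage Metric.isOpen_ball, ⟨hp, Metric.mem_ball_self hr⟩, ?_, ?_, ?_, ?_, ?_⟩
  · rintro y ⟨hy, hy'⟩
    simpa [e.left_inv hy] using (hball hy').2
  · refine e.continuousOn_symm.comp ?_ fun z hz ↦ (hball (hmem _ hz.2.2)).1
    refine continuousOn_const.add (ContinuousOn.smul (Continuous.continuousOn (by fun_prop)) ?_)
    exact ((e.continuousOn.comp continuousOn_snd fun z hz ↦ hz.2.1)).sub continuousOn_const
  · rintro y ⟨hy, hy'⟩
    simp [e.left_inv hp]
  · rintro y ⟨hy, hy'⟩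
    simp [e.left_inv hy]
  · rintro t y ⟨hy, hy'⟩
    have h2 := hmem t hy'
    exact ⟨e.map_target (hball h2).1, by simpa [e.right_inv (hball h2).1] using h2⟩

/-- Subtracting the coboundary of a function from a cochain. -/
theorem exists_sub_coboundary (c : (singularComplex M).X 1 →ₗ[ℝ] ℝ) (hc : IsCocycle c)
    (F : M → ℝ) : ∃ c' : (singularComplex M).X 1 →ₗ[ℝ] ℝ, IsCocycle c' ∧
      (∀ z : (singularComplex M).cycles 1, c' (((singularComplex M).iCycles 1).hom z) =
        c (((singularComplex M).iCycles 1).hom z)) ∧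
      ∀ γ : ℝ → M, ContinuousOn γ (Icc 0 1) →
        curveVal c' γ = curveVal c γ - (F (γ 1) - F (γ 0)) := by
  obtain ⟨l, hl⟩ := exists_linearMap_singleChain (k := 0) (M := M)
    fun σ ↦ F (σ (stdSimplex.vertex 0))
  refine ⟨c - l ∘ₗ ((singularComplex M).d 1 0).hom, fun b ↦ ?_, fun z ↦ ?_, fun γ hγ ↦ ?_⟩
  · have h1 : (singularComplex M).d 2 1 ≫ (singularComplex M).d 1 0 = 0 := by simp
    have h2 := congrArg (fun f ↦ f.hom b) h1
    simp only [ModuleCat.hom_comp, LinearMap.comp_apply] at h2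
    simp [hc b, h2]
  · have h1 : (singularComplex M).iCycles 1 ≫ (singularComplex M).d 1 0 = 0 := by simp
    have h2 := congrArg (fun f ↦ f.hom z) h1
    simp only [ModuleCat.hom_comp, LinearMap.comp_apply] at h2
    simp [h2]
  · have hcont := continuous_simplex_curve hγ
    rw [curveVal_of_continuous _ hcont, curveVal_of_continuous _ hcont, LinearMap.sub_apply,
      LinearMap.comp_apply, d_singleChain, map_sum, Fin.sum_univ_two]
    simp [hl, stdSimplex.map_vertex]
    ring

end Curves
-- Smooth `1`-forms: de Rham representatives of classes in `H¹(M; ℝ)`.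
section Forms

open Set Topology Bundle

variable {n : ℕ} {M : Type u} [TopologicalSpace M] [ChartedSpace (EuclideanSpace ℝ (Fin n)) M]
  [IsManifold (𝓡 n) ∞ M]

theorem contMDiff_mfderiv_section {s : M → ℝ} (hs : ContMDiff (𝓡 n) 𝓘(ℝ, ℝ) ∞ s) :
    ContMDiff (𝓡 n) ((𝓡 n).prod 𝓘(ℝ, EuclideanSpace ℝ (Fin n) →L[ℝ] ℝ)) ∞
    (fun x ↦ Bundle.TotalSpace.mk' (EuclideanSpace ℝ (Fin n) →L[ℝ] ℝ)
      (E := fun x : M ↦ TangentSpace (𝓡 n) x →L[ℝ] ℝ) x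
        (mfderiv (𝓡 n) 𝓘(ℝ, ℝ) s x : TangentSpace (𝓡 n) x →L[ℝ] ℝ)) := by
  intro x₀
  refine (contMDiffAt_hom_bundle (E₂ := Bundle.Trivial M ℝ) (F₂ := ℝ) _).2 ⟨contMDiffAt_id, ?_⟩
  have := (hs x₀).mfderiv_const (m := ∞) (by simp)
  refine this.congr_of_eventuallyEq (Filter.Eventually.of_forall fun x => ?_)
  ext v
  simp [inTangentCoordinates, ContinuousLinearMap.inCoordinates]
  rfl

theorem OneForm.continuous_eval (α : OneForm n M) :
    Continuous fun p : TangentBundle (𝓡 n) M ↦ α.toFun p.1 p.2 := by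
  have h := Continuous.clm_bundle_apply (𝕜 := ℝ) (B := M) (M := TangentBundle (𝓡 n) M)
    (E₂ := Bundle.Trivial M ℝ) (F₂ := ℝ) (F₁ := EuclideanSpace ℝ (Fin n))
    (E₁ := fun x : M ↦ TangentSpace (𝓡 n) x) (b := fun p => p.1) (ϕ := fun p => α.toFun p.1)
    (v := fun p => p.2)
    (α.contMDiff.continuous.comp (FiberBundle.continuous_proj _ _)) continuous_id
  have h2 := (Bundle.Trivial.homeomorphProd M ℝ).continuous.comp h
  exact continuous_snd.comp h2

theorem Metric.continuous_eval (g : Metric n M) :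
    Continuous fun p : TangentBundle (𝓡 n) M ↦ g.inner p.1 p.2 p.2 := by
  have h := Continuous.clm_bundle_apply₂ (𝕜 := ℝ) (B := M) (M := TangentBundle (𝓡 n) M)
    (E₃ := Bundle.Trivial M ℝ) (F₃ := ℝ) (F₁ := EuclideanSpace ℝ (Fin n))
    (E₁ := fun x : M ↦ TangentSpace (𝓡 n) x) (F₂ := EuclideanSpace ℝ (Fin n))
    (E₂ := fun x : M ↦ TangentSpace (𝓡 n) x) (b := fun p => p.1) (ψ := fun p => g.inner p.1)
    (v := fun p => p.2) (w := fun p => p.2)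
    (g.contMDiff.continuous.comp (FiberBundle.continuous_proj _ _)) continuous_id continuous_id
  have h2 := (Bundle.Trivial.homeomorphProd M ℝ).continuous.comp h
  exact continuous_snd.comp h2

theorem continuous_mfderiv_eval {f : M → ℝ} (hf : ContMDiff (𝓡 n) 𝓘(ℝ, ℝ) 1 f) :
    Continuous fun p : TangentBundle (𝓡 n) M ↦ (show ℝ from mfderiv (𝓡 n) 𝓘(ℝ, ℝ) f p.1 p.2) := by
  have h := hf.continuous_tangentMap le_rfl
  have h2 := (tangentBundleModelSpaceHomeomorph 𝓘(ℝ, ℝ)).continuous.comp h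
  exact continuous_snd.comp h2

/-- Holds because trivializations are linear on fibres; it yields the measurability of `toSpeed`. -/
theorem continuous_fiber_smul :
    Continuous fun z : ℝ × TangentBundle (𝓡 n) M ↦
      (⟨z.2.1, z.1 • z.2.2⟩ : TangentBundle (𝓡 n) M) := by
  rw [continuous_iff_continuousAt]
  intro z
  rw [FiberBundle.continuousAt_totalSpace]
  have hproj : Continuous fun z : ℝ × TangentBundle (𝓡 n) M ↦ z.2.1 :=
    (FiberBundle.continuous_proj _ _).comp continuous_snd
  refine ⟨hproj.continuousAt, ?_⟩
  set e := trivializationAt (EuclideanSpace ℝ (Fin n)) (fun x : M ↦ TangentSpace (𝓡 n) x) z.2.1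
  have hz : z.2.1 ∈ e.baseSet := mem_baseSet_trivializationAt _ _ _
  have h1 : ContinuousAt (fun z : ℝ × TangentBundle (𝓡 n) M ↦ z.1 • (e z.2).2) z := by
    have h2 : ContinuousAt (fun z : ℝ × TangentBundle (𝓡 n) M ↦ e z.2) z :=
      ContinuousAt.comp' (e.continuousAt (e.mem_source.2 hz)) continuousAt_snd
    exact continuousAt_fst.smul h2.snd
  refine h1.congr ?_
  filter_upwards [hproj.continuousAt.preimage_mem_nhds (e.open_baseSet.mem_nhds hz)] with w hw
  exact ((e.linear ℝ hw).map_smul w.1 w.2.2).symm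

/-- On `W`, the function `s` is a primitive both of the field of covectors `η` and of the
cochain `c`. -/
structure IsPrimitiveOn (η : ∀ x : M, TangentSpace (𝓡 n) x →L[ℝ] ℝ)
    (c : (singularComplex M).X 1 →ₗ[ℝ] ℝ) (s : M → ℝ) (W : Set M) : Prop where
  contMDiff : ContMDiff (𝓡 n) 𝓘(ℝ, ℝ) ∞ s
  mfderiv_eq : ∀ y ∈ W, η y = mfderiv (𝓡 n) 𝓘(ℝ, ℝ) s y
  hasPrimitiveOn : HasPrimitiveOn c s W

/-- The `1`-form whose local primitives are the local primitives of a cochain. -/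
def OneForm.ofLocalPrimitives (η : ∀ x : M, TangentSpace (𝓡 n) x →L[ℝ] ℝ)
    (c : (singularComplex M).X 1 →ₗ[ℝ] ℝ)
    (h : ∀ x : M, ∃ W s, IsOpen W ∧ x ∈ W ∧ IsPrimitiveOn η c s W) : OneForm n M where
  toFun := η
  contMDiff x := by
    obtain ⟨W, s, hW, hx, hs⟩ := h x
    refine (contMDiff_mfderiv_section hs.contMDiff x).congr_of_eventuallyEq ?_
    filter_upwards [hW.mem_nhds hx] with y hy
    rw [hs.mfderiv_eq y hy]

theorem continuous_velocity {γ : ℝ → M} (hγ : ContMDiff 𝓘(ℝ, ℝ) (𝓡 n) ∞ γ) :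
    Continuous fun t ↦ (⟨γ t, mfderiv 𝓘(ℝ, ℝ) (𝓡 n) γ t (1 : ℝ)⟩ : TangentBundle (𝓡 n) M) := by
  have h1 : Continuous fun t : ℝ ↦ (⟨t, (1 : ℝ)⟩ : TangentBundle 𝓘(ℝ, ℝ) ℝ) :=
    (tangentBundleModelSpaceHomeomorph 𝓘(ℝ, ℝ)).symm.continuous.comp
      (continuous_id.prodMk continuous_const)
  exact (hγ.continuous_tangentMap (by simp)).comp h1

theorem OneForm.curveVal_eq_curveIntegral (α : OneForm n M)
    {c : (singularComplex M).X 1 →ₗ[ℝ] ℝ} (hc : IsCocycle c)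
    (h : ∀ x : M, ∃ W s, IsOpen W ∧ x ∈ W ∧ IsPrimitiveOn α.toFun c s W)
    {γ : ℝ → M} (hγ : ContMDiff 𝓘(ℝ, ℝ) (𝓡 n) ∞ γ) :
    curveVal c γ = α.curveIntegral γ := by
  -- `Φ t` is the value of `c` on `γ` restricted to `[0, t]`. Near each `t` it differs from `s ∘ γ`
  -- by a constant, so its derivative is the integrand of `curveIntegral`.
  let Φ : ℝ → ℝ := fun t ↦ curveVal c fun u ↦ γ ((1 - u) * 0 + u * t)
  have hderiv (t : ℝ) :
      HasDerivAt Φ (α.toFun (γ t) (mfderiv 𝓘(ℝ, ℝ) (𝓡 n) γ t (1 : ℝ))) t := by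
    obtain ⟨W, s, hW, hx, hs⟩ := h (γ t)
    have h1 : HasMFDerivAt 𝓘(ℝ, ℝ) 𝓘(ℝ, ℝ) (s ∘ γ) t
        ((mfderiv (𝓡 n) 𝓘(ℝ, ℝ) s (γ t)).comp (mfderiv 𝓘(ℝ, ℝ) (𝓡 n) γ t)) :=
      ((hs.contMDiff.mdifferentiable (by simp)) (γ t)).hasMFDerivAt.comp t
        ((hγ.mdifferentiable (by simp)) t).hasMFDerivAt
    let D : ℝ →L[ℝ] ℝ := (mfderiv (𝓡 n) 𝓘(ℝ, ℝ) s (γ t)).comp (mfderiv 𝓘(ℝ, ℝ) (𝓡 n) γ t)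
    have h2 : HasDerivAt (s ∘ γ) (D 1) t :=
      HasFDerivAt.hasDerivAt (hasMFDerivAt_iff_hasFDerivAt.1 h1)
    have h3 := h2.const_add (Φ t - s (γ t))
    rw [hs.mfderiv_eq _ hx]
    refine h3.congr_of_eventuallyEq ?_
    obtain ⟨ε, hε, hball⟩ := Metric.isOpen_iff.1 (hW.preimage hγ.continuous) t hx
    filter_upwards [Metric.ball_mem_nhds t hε] with r hr
    have h4 := curveVal_segments hc hγ.continuous 0 t r
    have h5 := hs.hasPrimitiveOn (fun u ↦ γ ((1 - u) * t + u * r))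
      (hγ.continuous.comp (by fun_prop)).continuousOn (fun u hu ↦ by
        have := (convex_ball t ε) (Metric.mem_ball_self hε) hr (sub_nonneg.2 hu.2) hu.1 (by ring)
        exact hball this)
    simp only [sub_zero, one_mul, zero_mul, add_zero, sub_self, zero_add] at h5
    change Φ t + _ = Φ r at h4
    rw [← h4, h5]
    simp
    ring
  have hint := intervalIntegral.integral_eq_sub_of_hasDerivAt (a := 0) (b := 1)
    (fun t _ ↦ hderiv t)
    (α.continuous_eval.comp (continuous_velocity hγ)).continuousOn.intervalIntegrable
  rw [OneForm.curveIntegral, hint]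
  simp [Φ, curveVal_const hc]

/-- The local primitives `f i` of `c` need not be smooth, but on overlaps they differ by local
constants. Subtracting the coboundary of `∑ ρ i * f i` therefore leaves a cochain with local
primitives `-∑ ρ i * (constant)`, which are smooth. -/
theorem exists_isPrimitiveOn [CompactSpace M] [T2Space M]
    {c : (singularComplex M).X 1 →ₗ[ℝ] ℝ} (hc : IsCocycle c) :
    ∃ (c' : (singularComplex M).X 1 →ₗ[ℝ] ℝ) (η : ∀ x : M, TangentSpace (𝓡 n) x →L[ℝ] ℝ),
      IsCocycle c' ∧
      (∀ z : (singularComplex M).cycles 1, c' (((singularComplex M).iCycles 1).hom z) =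
        c (((singularComplex M).iCycles 1).hom z)) ∧
      ∀ x : M, ∃ W s, IsOpen W ∧ x ∈ W ∧ IsPrimitiveOn η c' s W := by
  choose U H hU hp _ hH using fun p : M ↦
    exists_isContractionOn (E := EuclideanSpace ℝ (Fin n)) p Filter.univ_mem
  obtain ⟨t, ht⟩ := isCompact_univ.elim_finite_subcover U hU fun x _ ↦ mem_iUnion.2 ⟨x, hp x⟩
  obtain ⟨ρ, hρ⟩ := SmoothPartitionOfUnity.exists_isSubordinate (𝓡 n) isClosed_univ
    (fun i : t ↦ U i) (fun i ↦ hU i) fun x hx ↦ by simpa using ht hx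
  let f : t → M → ℝ := fun i y ↦ curveVal c fun u ↦ H i (u, y)
  have hf (i : t) : HasPrimitiveOn c (f i) (U i) := (hH i).hasPrimitiveOn hc
  have hsum (y : M) : ∑ i, ρ i y = 1 := by
    rw [← finsum_eq_sum_of_fintype]
    exact ρ.sum_eq_one (mem_univ y)
  have hdiff (i : t) (y : M) : MDifferentiableAt (𝓡 n) 𝓘(ℝ, ℝ) (ρ i) y :=
    ((ρ i).contMDiff.mdifferentiable (by simp)) y
  obtain ⟨c', hc', hz, hcurve⟩ := exists_sub_coboundary c hc fun y ↦ ∑ i, ρ i y * f i y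
  -- The differential of the primitive `-∑ ρ i * f i x` at `x`, with the numbers `f i x` held
  -- constant.
  let η : ∀ x : M, TangentSpace (𝓡 n) x →L[ℝ] ℝ := fun x ↦
    -∑ i, f i x • (mfderiv (𝓡 n) 𝓘(ℝ, ℝ) (ρ i) x : TangentSpace (𝓡 n) x →L[ℝ] ℝ)
  refine ⟨c', η, hc', hz, fun x ↦ ?_⟩
  classical
  -- On this neighbourhood each index is either inactive or has `U i` containing the whole
  -- neighbourhood; in the latter case `f i` can be compared with `d`.
  have hN : (⋂ i : t, if x ∈ tsupport (ρ i) then U i else (tsupport (ρ i))ᶜ) ∈ 𝓝 x := by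
    refine Filter.iInter_mem.2 fun i ↦ ?_
    split_ifs with hi
    · exact (hU i).mem_nhds (hρ i hi)
    · exact (isClosed_tsupport _).isOpen_compl.mem_nhds hi
  obtain ⟨W, K, hW, hxW, hWN, hK⟩ := exists_isContractionOn (E := EuclideanSpace ℝ (Fin n)) x hN
  let d : M → ℝ := fun y ↦ curveVal c fun u ↦ K (u, y)
  have hd : HasPrimitiveOn c d W := hK.hasPrimitiveOn hc
  have hcase (i : t) : (∀ y ∈ W, y ∉ tsupport (ρ i)) ∨ ∀ y ∈ W, f i y = f i x + d y := by
    have hWi := hWN.trans (iInter_subset _ i)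
    split_ifs at hWi with hi
    · exact Or.inr fun y hy ↦ hK.primitive_eq hWi (hf i) hy
    · exact Or.inl fun y hy ↦ hWi hy
  have hF (y : M) (hy : y ∈ W) : ∑ i, ρ i y * f i y = ∑ i, ρ i y * f i x + d y := by
    have : ∑ i, ρ i y * f i y = ∑ i, ρ i y * (f i x + d y) := by
      refine Finset.sum_congr rfl fun i _ ↦ ?_
      rcases hcase i with h | h
      · rw [image_eq_zero_of_notMem_tsupport (h y hy), zero_mul, zero_mul]
      · rw [h y hy]
    simp_rw [this, mul_add, Finset.sum_add_distrib, ← Finset.sum_mul, hsum, one_mul]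
  refine ⟨W, fun y ↦ -∑ i, ρ i y * f i x, hW, hxW, ?_, fun y hy ↦ ?_, fun γ hγ hγW ↦ ?_⟩
  · exact (contMDiff_finsetSum fun i _ ↦ (ρ i).contMDiff.mul contMDiff_const).neg
  · let D : t → TangentSpace (𝓡 n) y →L[ℝ] ℝ := fun i ↦ mfderiv (𝓡 n) 𝓘(ℝ, ℝ) (ρ i) y
    have hder (a : t → ℝ) :
        HasMFDerivAt (𝓡 n) 𝓘(ℝ, ℝ) (fun y ↦ ∑ i, ρ i y * a i) y (∑ i, a i • D i) := by
      refine Finset.induction_on (motive := fun S ↦ HasMFDerivAt (𝓡 n) 𝓘(ℝ, ℝ)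
        (fun y ↦ ∑ i ∈ S, ρ i y * a i) y (∑ i ∈ S, a i • D i)) Finset.univ ?_ fun i S hi hS ↦ ?_
      · simp_rw [Finset.sum_empty]
        exact hasMFDerivAt_const _ _
      · have h1 := ((hdiff i y).hasMFDerivAt.const_smul (a i)).add hS
        have h2 : ∑ i ∈ insert i S, a i • D i = a i • D i + ∑ i ∈ S, a i • D i :=
          Finset.sum_insert hi
        refine (h1.congr_of_eventuallyEq (Filter.Eventually.of_forall fun z ↦ ?_)).congr_mfderiv
          h2.symm
        simp [Finset.sum_insert hi, mul_comm]
    -- Differentiate `∑ ρ i = 1`. This makes the common term `d y` drop out of `∑ (f i x + d y) • D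
    -- i`.
    have h0 : ∑ i, D i = 0 := by
      have h1 := hder fun _ ↦ 1
      have h4 : (fun y ↦ ∑ i, ρ i y * 1) = fun _ ↦ 1 := funext fun y ↦ by
        simp_rw [mul_one, hsum]
      rw [h4] at h1
      simp_rw [one_smul] at h1
      exact hasMFDerivAt_unique h1 (hasMFDerivAt_const _ _)
    have h2 := (hder fun i ↦ f i x).neg.mfderiv
    refine Eq.trans ?_ h2.symm
    have h3 : ∑ i, f i y • D i = ∑ i, (f i x + d y) • D i := by
      refine Finset.sum_congr rfl fun i _ ↦ ?_
      rcases hcase i with h | h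
      · have h4 : D i = 0 := by
          have h5 : (ρ i : M → ℝ) =ᶠ[𝓝 y] fun _ ↦ 0 := notMem_tsupport_iff_eventuallyEq.1 (h y hy)
          exact h5.mfderiv_eq.trans mfderiv_const
        rw [h4, smul_zero, smul_zero]
      · rw [h y hy]
    change -∑ i, f i y • D i = -∑ i, f i x • D i
    rw [h3]
    simp_rw [add_smul, Finset.sum_add_distrib]
    rw [← Finset.smul_sum, h0, smul_zero, add_zero]
  · rw [hcurve γ hγ, hd γ hγ hγW, hF _ (hγW (by simp)), hF _ (hγW (by simp))]
    ring

/-- Every class in `H¹(M; ℝ)` is the class of a closed `1`-form. -/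
theorem exists_oneForm_hasClass [CompactSpace M] [T2Space M] (φ : H1 M →ₗ[ℝ] ℝ) :
    ∃ α : OneForm n M, α.HasClass φ := by
  obtain ⟨c, hz, hc⟩ := exists_cocycle φ
  obtain ⟨c', η, hc', hz', h⟩ := exists_isPrimitiveOn (n := n) hc
  refine ⟨OneForm.ofLocalPrimitives η c' h, c', fun z ↦ (hz' z).trans (hz z), fun γ hγ ↦ ?_⟩
  rw [← curveVal_eq_simplexChain]
  exact OneForm.curveVal_eq_curveIntegral _ hc' h hγ

end Forms
-- Reparametrization of measures and the energy level of Mather measures.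
section Measures

open Set Topology Bundle MeasureTheory

variable {n : ℕ} {M : Type u} [TopologicalSpace M] [ChartedSpace (EuclideanSpace ℝ (Fin n)) M]
  [IsManifold (𝓡 n) ∞ M]

/-- The norm of a tangent vector. -/
def speed (g : Metric n M) (p : TangentBundle (𝓡 n) M) : ℝ := √(g.inner p.1 p.2 p.2)

theorem Metric.inner_self_nonneg (g : Metric n M) (p : TangentBundle (𝓡 n) M) :
    0 ≤ g.inner p.1 p.2 p.2 := by
  by_cases h : p.2 = 0
  · rw [h, map_zero]
  · exact (g.pos p.1 p.2 h).le

theorem speed_nonneg (g : Metric n M) (p : TangentBundle (𝓡 n) M) : 0 ≤ speed g p :=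
  Real.sqrt_nonneg _

theorem continuous_speed (g : Metric n M) : Continuous (speed g) :=
  Real.continuous_sqrt.comp g.continuous_eval

theorem speed_sq (g : Metric n M) (p : TangentBundle (𝓡 n) M) :
    speed g p ^ 2 = g.inner p.1 p.2 p.2 :=
  Real.sq_sqrt (g.inner_self_nonneg p)

theorem lagrangian_eq (g : Metric n M) (p : TangentBundle (𝓡 n) M) :
    lagrangian g p = 1 / 2 * speed g p ^ 2 := by
  rw [speed_sq, lagrangian]

theorem continuous_lagrangian (g : Metric n M) : Continuous (lagrangian g) :=
  continuous_const.mul g.continuous_eval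

theorem lagrangian_nonneg (g : Metric n M) (p : TangentBundle (𝓡 n) M) : 0 ≤ lagrangian g p := by
  rw [lagrangian_eq]
  positivity

theorem speed_eq_zero_iff (g : Metric n M) (p : TangentBundle (𝓡 n) M) :
    speed g p = 0 ↔ p.2 = 0 := by
  rw [speed, Real.sqrt_eq_zero (g.inner_self_nonneg p)]
  refine ⟨fun h ↦ ?_, fun h ↦ by rw [h, map_zero]⟩
  by_contra h'
  exact (g.pos p.1 p.2 h').ne' h

/-- Multiply nonzero tangent vectors by a positive factor so that their norm becomes `c`. -/
def toSpeed (g : Metric n M) (c : ℝ) (p : TangentBundle (𝓡 n) M) : TangentBundle (𝓡 n) M :=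
  -- At zero vectors the factor is `c / 0 = 0`, so they stay zero; they also have density zero in
  -- `constSpeed`.
  ⟨p.1, (c / speed g p) • p.2⟩

theorem measurable_toSpeed (g : Metric n M) (c : ℝ) : Measurable (toSpeed g c) :=
  (continuous_fiber_smul (n := n) (M := M)).measurable.comp
    ((measurable_const.div (continuous_speed g).measurable).prodMk measurable_id)

theorem speed_toSpeed (g : Metric n M) {c : ℝ} (hc : 0 ≤ c) {p : TangentBundle (𝓡 n) M}
    (hp : speed g p ≠ 0) : speed g (toSpeed g c p) = c := by
  have h : g.inner p.1 ((c / speed g p) • p.2) ((c / speed g p) • p.2) = c ^ 2 := by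
    simp only [map_smul, smul_apply, smul_eq_mul]
    rw [← speed_sq]
    field_simp
  rw [speed, toSpeed]
  dsimp only
  rw [h, Real.sqrt_sq hc]

/-- The density cancels the rescaling in any integrand linear in the velocity; hence `constSpeed`
preserves both closedness and the rotation vector. -/
theorem smul_toSpeed (g : Metric n M) {c : ℝ} (hc : c ≠ 0) (p : TangentBundle (𝓡 n) M)
    (l : TangentSpace (𝓡 n) p.1 →L[ℝ] ℝ) :
    speed g p / c * l ((c / speed g p) • p.2) = l p.2 := by
  by_cases hp : speed g p = 0
  · simp [(speed_eq_zero_iff g p).1 hp]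
  · rw [map_smul, smul_eq_mul]
    field_simp

/-- Reparametrization of a measure by the constant speed `c`. -/
def constSpeed (g : Metric n M) (c : ℝ) (μ : Measure (TangentBundle (𝓡 n) M)) :
    Measure (TangentBundle (𝓡 n) M) :=
  (μ.withDensity fun p ↦ ENNReal.ofReal (speed g p / c)).map (toSpeed g c)

variable {g : Metric n M} {c : ℝ} {μ : Measure (TangentBundle (𝓡 n) M)}

theorem measurable_density (g : Metric n M) (c : ℝ) :
    Measurable fun p ↦ ENNReal.ofReal (speed g p / c) :=
  ((continuous_speed g).measurable.div_const c).ennreal_ofReal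

theorem integral_constSpeed (hc : 0 ≤ c) {F : TangentBundle (𝓡 n) M → ℝ} (hF : Measurable F) :
    ∫ p, F p ∂constSpeed g c μ = ∫ p, speed g p / c * F (toSpeed g c p) ∂μ := by
  rw [constSpeed, integral_map (measurable_toSpeed g c).aemeasurable hF.aestronglyMeasurable,
    integral_withDensity_eq_integral_toReal_smul (measurable_density g c) (by simp)]
  refine integral_congr_ae (Filter.Eventually.of_forall fun p ↦ ?_)
  simp [ENNReal.toReal_ofReal (div_nonneg (speed_nonneg g p) hc)]

theorem integrable_constSpeed (hc : 0 ≤ c) {F : TangentBundle (𝓡 n) M → ℝ} (hF : Measurable F)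
    (h : Integrable (fun p ↦ speed g p / c * F (toSpeed g c p)) μ) :
    Integrable F (constSpeed g c μ) := by
  rw [constSpeed, integrable_map_measure hF.aestronglyMeasurable
    (measurable_toSpeed g c).aemeasurable,
    integrable_withDensity_iff (measurable_density g c) (by simp)]
  refine h.congr (Filter.Eventually.of_forall fun p ↦ ?_)
  simp [ENNReal.toReal_ofReal (div_nonneg (speed_nonneg g p) hc), mul_comm]

/-- Taking `c` to be the mean speed is what makes the new total mass `∫ speed / c` equal to `1`. -/
theorem IsClosedMeasure.constSpeed (h : IsClosedMeasure g μ) (hc : 0 < c)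
    (hcμ : ∫ p, speed g p ∂μ = c) : IsClosedMeasure g (constSpeed g c μ) where
  isProbabilityMeasure := by
    refine ⟨?_⟩
    have hint : Integrable (fun p ↦ speed g p / c) μ := h.integrable_norm.div_const c
    rw [MatherTheory.constSpeed, Measure.map_apply (measurable_toSpeed g c) MeasurableSet.univ,
      preimage_univ, withDensity_apply _ MeasurableSet.univ, setLIntegral_univ,
      ← ofReal_integral_eq_lintegral_ofReal hint
        (Filter.Eventually.of_forall fun p ↦ div_nonneg (speed_nonneg g p) hc.le),
      integral_div, hcμ, div_self hc.ne', ENNReal.ofReal_one]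
  integrable_norm := by
    refine integrable_constSpeed hc.le (continuous_speed g).measurable
      (h.integrable_norm.congr (Filter.Eventually.of_forall fun p ↦ ?_))
    change speed g p = speed g p / c * speed g (toSpeed g c p)
    by_cases hp : speed g p = 0
    · simp [hp]
    · rw [speed_toSpeed g hc.le hp]
      field_simp
  closed f hf := by
    rw [integral_constSpeed hc.le (continuous_mfderiv_eval hf).measurable, ← h.closed f hf]
    refine integral_congr_ae (Filter.Eventually.of_forall fun p ↦ ?_)
    exact smul_toSpeed g hc.ne' p (mfderiv (𝓡 n) 𝓘(ℝ, ℝ) f p.1)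

theorem HasRotationVector.constSpeed {h : H1 M} (hμ : HasRotationVector μ h) (hc : 0 < c) :
    HasRotationVector (constSpeed g c μ) h := by
  intro α φ hα
  rw [integral_constSpeed hc.le α.continuous_eval.measurable, ← hμ α φ hα]
  exact integral_congr_ae (Filter.Eventually.of_forall fun p ↦
    smul_toSpeed g hc.ne' p (α.toFun p.1))

theorem speed_mul_lagrangian_toSpeed (g : Metric n M) (hc : 0 < c) (p : TangentBundle (𝓡 n) M) :
    speed g p / c * lagrangian g (toSpeed g c p) = c / 2 * speed g p := by
  by_cases hp : speed g p = 0
  · simp [hp]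
  · rw [lagrangian_eq, speed_toSpeed g hc.le hp]
    field_simp

theorem beta_le {h : H1 M} (hμ : IsClosedMeasure g μ) (hh : HasRotationVector μ h)
    (hL : Integrable (lagrangian g) μ) : beta g h ≤ ∫ p, lagrangian g p ∂μ := by
  refine csInf_le ⟨0, ?_⟩ ⟨μ, hμ, hh, hL, rfl⟩
  rintro a ⟨ν, -, -, -, rfl⟩
  exact integral_nonneg (lagrangian_nonneg g)

/-- With mean speed zero, `μ` lives on the zero section and every `1`-form integrates to `0`. By
`exists_oneForm_hasClass` every functional then vanishes on `h`, and functionals separate points. -/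
theorem HasRotationVector.integral_speed_pos [CompactSpace M] [T2Space M] {h : H1 M}
    (hμ : HasRotationVector μ h) (hint : Integrable (speed g) μ) (hh : h ≠ 0) :
    0 < ∫ p, speed g p ∂μ := by
  refine lt_of_le_of_ne (integral_nonneg (speed_nonneg g)) fun h0 ↦ hh ?_
  rw [eq_comm, integral_eq_zero_iff_of_nonneg (speed_nonneg g) hint] at h0
  rw [← Module.forall_dual_apply_eq_zero_iff ℝ h]
  intro φ
  obtain ⟨α, hα⟩ := exists_oneForm_hasClass (n := n) φ
  rw [← hμ α φ hα]
  refine integral_eq_zero_of_ae ?_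
  filter_upwards [h0] with p hp
  rw [(speed_eq_zero_iff g p).1 hp, map_zero]
  rfl

/-- The Mather measures of a nonzero class are supported in an energy level. -/
theorem IsMatherMeasure.exists_speed_eq [CompactSpace M] [T2Space M] {h : H1 M}
    (hμ : IsMatherMeasure g h μ) (hh : h ≠ 0) :
    ∃ c, 0 < c ∧ ∀ᵐ p ∂μ, speed g p = c := by
  have := hμ.isClosedMeasure.isProbabilityMeasure
  have hint : Integrable (speed g) μ := hμ.isClosedMeasure.integrable_norm
  have hc := hμ.hasRotationVector.integral_speed_pos hint hh
  obtain ⟨c, hcμ⟩ : ∃ c, ∫ p, speed g p ∂μ = c := ⟨_, rfl⟩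
  rw [hcμ] at hc
  refine ⟨c, hc, ?_⟩
  have hL := hμ.integrable_lagrangian
  -- The rescaled measure is a competitor of action `c² / 2`, so minimality gives `∫ L dμ ≤ c² / 2`.
  have hle := beta_le (hμ.isClosedMeasure.constSpeed hc hcμ) (hμ.hasRotationVector.constSpeed hc)
    (integrable_constSpeed hc.le (continuous_lagrangian g).measurable (by
      simp_rw [speed_mul_lagrangian_toSpeed g hc]
      exact hint.const_mul _))
  rw [integral_constSpeed hc.le (continuous_lagrangian g).measurable,
    ← hμ.integral_lagrangian] at hle
  simp_rw [speed_mul_lagrangian_toSpeed g hc] at hle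
  rw [integral_const_mul, hcμ] at hle
  have heq (p) : (speed g p - c) ^ 2 = 2 * lagrangian g p - 2 * c * speed g p + c ^ 2 := by
    rw [lagrangian_eq]
    ring
  have hi1 : Integrable (fun p ↦ 2 * lagrangian g p - 2 * c * speed g p) μ :=
    (hL.const_mul 2).sub (hint.const_mul (2 * c))
  have hi2 : Integrable (fun p ↦ (speed g p - c) ^ 2) μ := by
    simp_rw [heq]
    exact hi1.add (integrable_const _)
  have hsq : ∫ p, (speed g p - c) ^ 2 ∂μ = 2 * ∫ p, lagrangian g p ∂μ - c ^ 2 := by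
    simp_rw [heq]
    rw [integral_add hi1 (integrable_const _),
      integral_sub (hL.const_mul 2) (hint.const_mul (2 * c)), integral_const_mul,
      integral_const_mul, hcμ]
    simp
    ring
  -- The variance of the speed is `2 ∫ L dμ - c²`, which is at most `0` by `hle`.
  have h0 : ∫ p, (speed g p - c) ^ 2 ∂μ = 0 :=
    le_antisymm (by rw [hsq]; linarith) (integral_nonneg fun p ↦ sq_nonneg _)
  rw [integral_eq_zero_iff_of_nonneg (fun p ↦ sq_nonneg _) hi2] at h0
  filter_upwards [h0] with p hp
  exact sub_eq_zero.1 (pow_eq_zero_iff two_ne_zero |>.1 hp)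

/-- The set where the two functions differ is open and null, so it misses the support. -/
theorem eq_of_mem_support_of_ae_eq {X : Type*} [TopologicalSpace X] [MeasurableSpace X]
    {ν : Measure X} {f f' : X → ℝ} (hf : Continuous f) (hf' : Continuous f')
    (h : ∀ᵐ x ∂ν, f x = f' x) {x : X} (hx : x ∈ ν.support) : f x = f' x := by
  by_contra hne
  exact ((Measure.mem_support_iff_forall x).1 hx _
    ((isOpen_ne_fun hf hf').mem_nhds hne)).ne' h

/-! ### Comparison of actions for conformal metrics. -/

section Conformal

variable {g₁ g₂ : Metric n M} {φ : M → ℝ}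

theorem lagrangian_conformal
    (hg : ∀ (x : M) (v w : TangentSpace (𝓡 n) x), g₂.inner x v w = φ x * g₁.inner x v w)
    (p : TangentBundle (𝓡 n) M) : lagrangian g₂ p = φ p.1 * lagrangian g₁ p := by
  rw [lagrangian, lagrangian, hg]
  ring

theorem IsClosedMeasure.conformal {m : ℝ} (hm : ∀ x, φ x ≤ m) (hφ : ∀ x, 0 < φ x)
    (hg : ∀ (x : M) (v w : TangentSpace (𝓡 n) x), g₂.inner x v w = φ x * g₁.inner x v w)
    (h : IsClosedMeasure g₁ μ) : IsClosedMeasure g₂ μ where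
  isProbabilityMeasure := h.isProbabilityMeasure
  integrable_norm := by
    refine (h.integrable_norm.const_mul (√m)).mono'
      (continuous_speed g₂).aestronglyMeasurable (Filter.Eventually.of_forall fun p ↦ ?_)
    rw [hg, Real.sqrt_mul (hφ _).le, Real.norm_of_nonneg (by positivity)]
    gcongr
    exact hm _
  closed := h.closed

theorem integrable_lagrangian_conformal {m : ℝ} (hm : ∀ x, φ x ≤ m)
    (hg : ∀ (x : M) (v w : TangentSpace (𝓡 n) x), g₂.inner x v w = φ x * g₁.inner x v w)
    (h : Integrable (lagrangian g₁) μ) : Integrable (lagrangian g₂) μ := by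
  refine (h.const_mul m).mono' (continuous_lagrangian g₂).aestronglyMeasurable
    (Filter.Eventually.of_forall fun p ↦ ?_)
  rw [Real.norm_of_nonneg (lagrangian_nonneg _ _), lagrangian_conformal hg]
  exact mul_le_mul_of_nonneg_right (hm _) (lagrangian_nonneg _ _)

/-- Homothetic metrics have the same competitors, seen by applying the conformal lemmas with the
constant factors `m` and `m⁻¹`; each action is multiplied by `m`. -/
theorem beta_smul {m : ℝ} (hm : 0 < m)
    (hg : ∀ (x : M) (v w : TangentSpace (𝓡 n) x), g₂.inner x v w = m * g₁.inner x v w)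
    (h : H1 M) : beta g₂ h = m * beta g₁ h := by
  have hg' (x : M) (v w : TangentSpace (𝓡 n) x) : g₁.inner x v w = m⁻¹ * g₂.inner x v w := by
    rw [hg, inv_mul_cancel_left₀ hm.ne']
  rw [beta, beta, ← smul_eq_mul, ← Real.sInf_smul_of_nonneg hm.le]
  congr 1
  ext a
  rw [mem_smul_set]
  constructor
  · rintro ⟨μ, h1, h2, h3, rfl⟩
    refine ⟨_, ⟨μ, h1.conformal (φ := fun _ ↦ m⁻¹) (fun _ ↦ le_rfl) (fun _ ↦ inv_pos.2 hm) hg', h2,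
      integrable_lagrangian_conformal (φ := fun _ ↦ m⁻¹) (fun _ ↦ le_rfl) hg' h3, rfl⟩, ?_⟩
    rw [smul_eq_mul, ← integral_const_mul]
    exact integral_congr_ae (Filter.Eventually.of_forall fun p ↦
      (lagrangian_conformal (φ := fun _ ↦ m) hg p).symm)
  · rintro ⟨_, ⟨μ, h1, h2, h3, rfl⟩, rfl⟩
    refine ⟨μ, h1.conformal (φ := fun _ ↦ m) (fun _ ↦ le_rfl) (fun _ ↦ hm) hg, h2,
      integrable_lagrangian_conformal (φ := fun _ ↦ m) (fun _ ↦ le_rfl) hg h3, ?_⟩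
    rw [smul_eq_mul, ← integral_const_mul]
    exact integral_congr_ae (Filter.Eventually.of_forall fun p ↦
      (lagrangian_conformal (φ := fun _ ↦ m) hg p))

/-- A Mather measure of `g₁` competes for `g₂`, so `hβ` squeezes the integral of the nonnegative
function `m L_{g₁} - L_{g₂}` to zero. -/
theorem IsMatherMeasure.ae_conformal_eq {m : ℝ} (hm : ∀ x, φ x ≤ m)
    (hφ : ∀ x, 0 < φ x)
    (hg : ∀ (x : M) (v w : TangentSpace (𝓡 n) x), g₂.inner x v w = φ x * g₁.inner x v w)
    {h : H1 M} (hβ : beta g₂ h = m * beta g₁ h) (hμ : IsMatherMeasure g₁ h μ) :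
    ∀ᵐ p ∂μ, lagrangian g₂ p = m * lagrangian g₁ p := by
  have hL := hμ.integrable_lagrangian
  have hL2 := integrable_lagrangian_conformal hm hg hL
  have hle := beta_le (hμ.isClosedMeasure.conformal hm hφ hg) hμ.hasRotationVector hL2
  have hnn (p : TangentBundle (𝓡 n) M) : 0 ≤ m * lagrangian g₁ p - lagrangian g₂ p := by
    rw [lagrangian_conformal hg, ← sub_mul]
    exact mul_nonneg (sub_nonneg.2 (hm _)) (lagrangian_nonneg _ _)
  have h0 : ∫ p, (m * lagrangian g₁ p - lagrangian g₂ p) ∂μ = 0 := by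
    refine le_antisymm ?_ (integral_nonneg hnn)
    rw [integral_sub (hL.const_mul m) hL2, integral_const_mul, hμ.integral_lagrangian, ← hβ]
    linarith
  rw [integral_eq_zero_iff_of_nonneg hnn ((hL.const_mul m).sub hL2)] at h0
  filter_upwards [h0] with p hp
  exact (sub_eq_zero.1 hp).symm

end Conformal

end Measures
end MatherTheory

end

/-! ### The rigidity theorem. -/

theorem mainTheorem2 {n : ℕ} {M : Type u} [TopologicalSpace M]
    [ChartedSpace (EuclideanSpace ℝ (Fin n)) M] [IsManifold (𝓡 n) ∞ M]
    [CompactSpace M] [T2Space M]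
    (g₁ g₂ : MatherTheory.Metric n M) (φ : M → ℝ) (hφ : ContMDiff (𝓡 n) 𝓘(ℝ, ℝ) ∞ φ)
    (hφ_pos : ∀ x, 0 < φ x)
    (hg : ∀ (x : M) (v w : TangentSpace (𝓡 n) x), g₂.inner x v w = φ x * g₁.inner x v w)
    (m : ℝ) (hm : IsGreatest (Set.range φ) m)
    (hne : (MatherTheory.fullClasses g₁).Nonempty) :
    (∃ h ∈ MatherTheory.fullClasses g₁, MatherTheory.beta g₂ h = m * MatherTheory.beta g₁ h) ↔
      ∀ (x : M) (v w : TangentSpace (𝓡 n) x), g₂.inner x v w = m * g₁.inner x v w := by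
  have hle (x : M) : φ x ≤ m := hm.2 ⟨x, rfl⟩
  constructor
  · rintro ⟨h, ⟨h0, hfull⟩, hβ⟩ x v w
    obtain ⟨p, hp, rfl⟩ : x ∈ MatherTheory.projectedMatherSet g₁ h := hfull ▸ Set.mem_univ x
    obtain ⟨μ, hμ, hp⟩ := Set.mem_iUnion₂.1 hp
    obtain ⟨c, hc, hspeed⟩ := MatherTheory.IsMatherMeasure.exists_speed_eq hμ h0
    have h1 := MatherTheory.eq_of_mem_support_of_ae_eq (MatherTheory.continuous_speed g₁)
      continuous_const hspeed hp
    have h2 := MatherTheory.eq_of_mem_support_of_ae_eq (MatherTheory.continuous_lagrangian g₂)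
      (continuous_const.mul (MatherTheory.continuous_lagrangian g₁))
      (MatherTheory.IsMatherMeasure.ae_conformal_eq hle hφ_pos hg hβ hμ) hp
    change MatherTheory.lagrangian g₂ p = m * MatherTheory.lagrangian g₁ p at h2
    rw [MatherTheory.lagrangian_conformal hg, MatherTheory.lagrangian_eq, h1] at h2
    -- Positivity of the energy at `p` allows cancelling it from `φ p.1 * (c² / 2) = m * (c² / 2)`.
    have h3 : (1 / 2 * c ^ 2 : ℝ) ≠ 0 := by positivity
    rw [hg, mul_right_cancel₀ h3 h2]
  · intro hgm
    obtain ⟨h, hh⟩ := hne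
    -- The maximum is attained, so `m = φ x` is positive.
    obtain ⟨x, rfl⟩ := hm.1
    exact ⟨h, hh, MatherTheory.beta_smul (hφ_pos x) hgm h⟩
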